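/- **Corollary 1.3.** Work in $\mathbb{Z}[\beta][[x_1,x_2,\dots]]$. For every partition $\lambda$, $$G_\lambda=\sum_{\alpha:\ \lambda(\alpha)=\lambda}\mathcal{G}_\alpha ,$$ where the sum is over all compositions $\alpha$ (finite sequences of positive integers) such that $\lambda(\alpha)$, the weakly decreasing rearrangement of $\alpha$, equals $\lambda$. The notation is as follows. *Symmetric Grothendieck functions.* A set-valued reverse tableau of shape $\lambda$ is a filling $T$ of the boxes of the Young diagram of $\lambda$ (English convention) with nonempty finite sets of positive integers which weakly decrease along rows and strictly decrease down columns; for sets, $A\ge B$ (resp. $A>B$) means $\min A\ge\max B$ (resp. $\min A>\max B$). Let $x^T$ be the product of $x_m$ over all entries $m$ of $T$, and $|T|$ its degree, i.e. the total number of entries. Then $G_\lambda=\sum_T\beta^{|T|-|\lambda|}x^T$, over all set-valued reverse tableaux $T$ of shape $\lambda$. *Set-valued skyline fillings.* A weak composition $\gamma=(\gamma_1,\gamma_2,\dots)$ is a sequence of nonnegative integers with finitely many nonzero terms (that is, weak compositions are considered up to zeros at the end), and $|\gamma|=\sum_i\gamma_i$. Its skyline diagram with basement $b_i=i$ has $\gamma_i$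 left-justified boxes $(i,1),\dots,(i,\gamma_i)$ in row $i$, and a basement box $(i,0)$ containing $i$; rows are numbered from top to bottom. A set-valued filling $F$ assigns a nonempty finite set $F(i,c)$ of positive integers to each box $(i,c)$, $1\le c\le\gamma_i$, and $F(i,0)=\{i\}$. The maximum of a box is its anchor entry, the other entries are free. $F$ is semistandard if - (S1) no integer occurs in two boxes of one column; - (S2) $\min F(i,c)\ge\max F(i,c+1)$ whenever both boxes exist (including $c=0$); - (S3) every triple of anchor entries (including those with basement boxes) is an inversion triple, i.e. satisfies $b>c\ge a$ or $c\ge a>b$. The triples are, for rows $i<j$ and $k\ge0$: if $\gamma_i\ge\gamma_j$, the anchor entries $c,a,b$ of the boxes $(i,k),(i,k+1),(j,k+1)$ (type A); if $\gamma_i<\gamma_j$, the anchor entries $b,c,a$ of the boxes $(i,k),(j,k),(j,k+1)$ (type B); in each case whenever the three boxes exist; - (S4) every free entry is in the highest possible row: if $e$ is a free entry of $(i,c)$, there is no $i'<i$ such that the box $(i',c)$ exists, $e<\max F(i',c)$, and $e\ge\max F(i',c+1)$ if the box $(i',c+1)$ exists. Let $x^F$ be the product of $x_m$ over all entries $m$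 of $F$ outside the basement, and $|F|$ its degree. The combinatorial Lascoux atom is $\mathcal{L}_\gamma=\sum_F\beta^{|F|-|\gamma|}x^F$, over all semistandard set-valued fillings $F$ of shape $\gamma$ with basement $b_i=i$. *Quasisymmetric Grothendieck functions.* For a composition $\alpha$, $\mathcal{G}_\alpha=\sum_{\gamma:\ \gamma^+=\alpha}\mathcal{L}_\gamma$, over all weak compositions $\gamma$ such that $\gamma^+$, the composition obtained from $\gamma$ by dropping its zero parts, equals $\alpha$. All sums of power series are formal: every monomial occurs in finitely many summands only. -/

import Mathlib

open scoped Classical in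
/-- The formal sum of a family of power series, coefficient by coefficient. It is used below only
for families in which every monomial has a nonzero coefficient in finitely many members; this is
proved for each of them: `locallyFinite_lascouxAtom`, `locallyFinite_quasiGrothendieck`,
`locallyFinite_grothendieck`. -/
noncomputable def formalSum {ι σ R : Type*} [CommSemiring R] (f : ι → MvPowerSeries σ R) :
    MvPowerSeries σ R :=
  fun d => ∑ᶠ i, MvPowerSeries.coeff d (f i)

/-- Every monomial occurs in only finitely many members of the family, so that its formal sum is
meaningful. -/
def LocallyFiniteFamily {ι σ R : Type*} [CommSemiring R] (f : ι → MvPowerSeries σ R) : Prop :=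
  ∀ d : σ →₀ ℕ, {i | MvPowerSeries.coeff d (f i) ≠ 0}.Finite

/-- The ring `ℤ[β][[x₁, x₂, …]]`, with one variable for every positive integer. -/
abbrev GrothSeries : Type := MvPowerSeries ℕ+ (Polynomial ℤ)

/-- The anchor entry (maximum) of a box. It is only used for nonempty boxes; the empty set has the
default value `1`. -/
def anchor (A : Finset ℕ+) : ℕ+ := A.sup id

/-- `a`, `b`, `c` form an inversion triple, the letters being as in the pictures of type A
(row `i`: `c a`, row `j`: `b` below `a`) and type B (row `j`: `c a`, row `i`: `b` above `c`). -/
def IsInversionTriple (a b c : ℕ+) : Prop := (c < b ∧ a ≤ c) ∨ (a ≤ c ∧ b < a)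

/-- Semistandard set-valued skyline fillings of shape `γ` and basement `bᵢ = i`.

A weak composition, considered up to zero parts at its end, is a finitely supported function on
the positive integers. Rows are indexed by `1, 2, …` from top to bottom. Column `0` is the
basement, and the boxes proper of row `i` lie in the columns `1, …, γ i`. -/
@[ext] structure SetSkyFill (γ : ℕ+ →₀ ℕ) where
  /-- the set in row `i` and column `c` (empty outside the diagram) -/
  entry : ℕ+ → ℕ → Finset ℕ+
  nonempty_iff : ∀ i c, (entry i c).Nonempty ↔ c ≤ γ i
  basement : ∀ i, entry i 0 = {i}
  /-- (S1) entries do not repeat in a column -/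
  column_disjoint : ∀ i j c, i ≠ j → Disjoint (entry i c) (entry j c)
  /-- (S2) rows are weakly decreasing, basement included -/
  row_weak : ∀ i c, ∀ a ∈ entry i c, ∀ b ∈ entry i (c + 1), b ≤ a
  /-- (S3) for triples of type A -/
  triple_A : ∀ i j k, i < j → γ j ≤ γ i → k + 1 ≤ γ j →
    IsInversionTriple (anchor (entry i (k + 1))) (anchor (entry j (k + 1))) (anchor (entry i k))
  /-- (S3) for triples of type B -/
  triple_B : ∀ i j k, i < j → γ i < γ j → k ≤ γ i →
    IsInversionTriple (anchor (entry j (k + 1))) (anchor (entry i k)) (anchor (entry j k))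
  /-- (S4) a free entry `e` is in the highest row possible: it could not be a free entry of the
  box in the same column of a higher row `i'` without violating (S2) -/
  free_highest : ∀ i c, ∀ e ∈ entry i c, e ≠ anchor (entry i c) → ∀ i' < i, c ≤ γ i' →
    ¬ (e < anchor (entry i' c) ∧ ∀ b ∈ entry i' (c + 1), b ≤ e)

/-- The content of a skyline filling: how often every positive integer occurs in it, the basement
excluded. -/
noncomputable def SetSkyFill.content {γ : ℕ+ →₀ ℕ} (F : SetSkyFill γ) : ℕ+ →₀ ℕ :=
  ∑ i ∈ γ.support, ∑ c ∈ Finset.Icc 1 (γ i), ∑ m ∈ F.entry i c, Finsupp.single m 1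

/-- The combinatorial Lascoux atom `𝓛_γ = ∑_F β^(|F| - |γ|) x^F`. (Always `|γ| ≤ |F|`, as boxes
are nonempty.) -/
noncomputable def lascouxAtom (γ : ℕ+ →₀ ℕ) : GrothSeries :=
  formalSum fun F : SetSkyFill γ =>
    MvPowerSeries.monomial F.content (Polynomial.X ^ (F.content.degree - γ.degree))

/-- `γ⁺`: the list of the nonzero parts of `γ`, in order. -/
def positivePart (γ : ℕ+ →₀ ℕ) : List ℕ := (γ.support.sort (· ≤ ·)).map γ

/-- The quasisymmetric Grothendieck function `𝓖_α = ∑_{γ⁺ = α} 𝓛_γ`. -/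
noncomputable def quasiGrothendieck {n : ℕ} (α : Composition n) : GrothSeries :=
  formalSum fun γ : {γ : ℕ+ →₀ ℕ // positivePart γ = α.blocks} => lascouxAtom γ.1

/-- The diagram of a partition. -/
def partitionDiagram {n : ℕ} (lam : n.Partition) : YoungDiagram :=
  YoungDiagram.ofRowLens (lam.parts.sort (· ≥ ·)) (Multiset.pairwise_sort _ _).sortedGE

/-- Set-valued reverse tableaux of shape `μ`: boxes hold nonempty sets of positive integers, which
weakly decrease along rows and strictly decrease down columns. -/
@[ext] structure SetRT (μ : YoungDiagram) where
  /-- the set in row `i` and column `j` (empty outside the diagram) -/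
  entry : ℕ → ℕ → Finset ℕ+
  nonempty_iff : ∀ i j, (entry i j).Nonempty ↔ (i, j) ∈ μ
  row_weak : ∀ i j, ∀ a ∈ entry i j, ∀ b ∈ entry i (j + 1), b ≤ a
  column_strict : ∀ i j, ∀ a ∈ entry i j, ∀ b ∈ entry (i + 1) j, b < a

/-- The content of a set-valued tableau. -/
noncomputable def SetRT.content {μ : YoungDiagram} (T : SetRT μ) : ℕ+ →₀ ℕ :=
  ∑ x ∈ μ.cells, ∑ m ∈ T.entry x.1 x.2, Finsupp.single m 1

/-- The symmetric Grothendieck function `G_λ = ∑_T β^(|T| - |λ|) x^T`, the sum over all set-valued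
reverse tableaux of shape `λ`. -/
noncomputable def grothendieck {n : ℕ} (lam : n.Partition) : GrothSeries :=
  formalSum fun T : SetRT (partitionDiagram lam) =>
    MvPowerSeries.monomial T.content (Polynomial.X ^ (T.content.degree - n))

/-! The formal sums above are locally finite. -/

theorem finite_setValued {A : Type*} (s : Finset A) (S : Finset ℕ+) :
    {f : A → Finset ℕ+ | (∀ a ∈ s, f a ⊆ S) ∧ ∀ a ∉ s, f a = ∅}.Finite := by
  classical
  refine Set.Finite.of_finite_image (f := fun f => fun a : s => f a.1) ?_ ?_
  · refine (Set.Finite.pi' (t := fun _ : s => {B : Finset ℕ+ | B ⊆ S}) fun _ => ?_).subset ?_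
    · exact (S.powerset.finite_toSet).subset fun B hB => by simpa using hB
    · rintro _ ⟨f, hf, rfl⟩ a
      exact hf.1 a.1 a.2
  · intro f hf g hg h
    funext a
    by_cases ha : a ∈ s
    · exact congrFun h ⟨a, ha⟩
    · rw [hf.2 a ha, hg.2 a ha]

theorem SetSkyFill.subset_content {γ : ℕ+ →₀ ℕ} (F : SetSkyFill γ) (i : ℕ+) (c : ℕ) (hc : 1 ≤ c) :
    F.entry i c ⊆ F.content.support := by
  intro m hm
  have hle : c ≤ γ i := (F.nonempty_iff i c).1 ⟨m, hm⟩
  have hi : i ∈ γ.support := by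
    rw [Finsupp.mem_support_iff]; omega
  have h1 : Finsupp.single m 1 ≤ F.content :=
    calc Finsupp.single m 1 ≤ ∑ m ∈ F.entry i c, Finsupp.single m 1 :=
          Finset.single_le_sum (f := fun m : ℕ+ => (Finsupp.single m 1 : ℕ+ →₀ ℕ))
            (fun _ _ => zero_le) hm
      _ ≤ ∑ c ∈ Finset.Icc 1 (γ i), ∑ m ∈ F.entry i c, Finsupp.single m 1 :=
          Finset.single_le_sum
            (f := fun c => (∑ m ∈ F.entry i c, Finsupp.single m 1 : ℕ+ →₀ ℕ))
            (fun _ _ => zero_le) (Finset.mem_Icc.2 ⟨hc, hle⟩)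
      _ ≤ F.content :=
          Finset.single_le_sum
            (f := fun i => (∑ c ∈ Finset.Icc 1 (γ i), ∑ m ∈ F.entry i c,
              Finsupp.single m 1 : ℕ+ →₀ ℕ))
            (fun _ _ => zero_le) hi
  have h2 := h1 m
  rw [Finsupp.single_eq_same] at h2
  rw [Finsupp.mem_support_iff]; omega

theorem SetRT.subset_content {μ : YoungDiagram} (T : SetRT μ) (i j : ℕ) :
    T.entry i j ⊆ T.content.support := by
  intro m hm
  have hi : (i, j) ∈ μ.cells := (T.nonempty_iff i j).1 ⟨m, hm⟩
  have h1 : Finsupp.single m 1 ≤ T.content :=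
    calc Finsupp.single m 1 ≤ ∑ m ∈ T.entry i j, Finsupp.single m 1 :=
          Finset.single_le_sum (f := fun m : ℕ+ => (Finsupp.single m 1 : ℕ+ →₀ ℕ))
            (fun _ _ => zero_le) hm
      _ ≤ T.content :=
          Finset.single_le_sum
            (f := fun x : ℕ × ℕ => (∑ m ∈ T.entry x.1 x.2, Finsupp.single m 1 : ℕ+ →₀ ℕ))
            (fun _ _ => zero_le) hi
  have h2 := h1 m
  rw [Finsupp.single_eq_same] at h2
  rw [Finsupp.mem_support_iff]; omega

theorem eq_of_coeff_monomial_ne_zero {d e : ℕ+ →₀ ℕ} {p : Polynomial ℤ}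
    (h : MvPowerSeries.coeff d (MvPowerSeries.monomial e p) ≠ 0) : e = d := by
  classical
  rw [MvPowerSeries.coeff_monomial] at h
  by_contra hne
  exact h (if_neg (Ne.symm hne))

theorem locallyFinite_lascouxAtom (γ : ℕ+ →₀ ℕ) :
    LocallyFiniteFamily fun F : SetSkyFill γ =>
      (MvPowerSeries.monomial F.content
        (Polynomial.X ^ (F.content.degree - γ.degree)) : GrothSeries) := by
  classical
  intro d
  let s : Finset (ℕ+ × ℕ) := γ.support ×ˢ Finset.Icc 1 (γ.support.sup γ)
  refine Set.Finite.of_finite_image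
    (f := fun F (x : ℕ+ × ℕ) => if x.2 = 0 then ∅ else F.entry x.1 x.2) ?_ ?_
  · refine (finite_setValued s d.support).subset ?_
    rintro _ ⟨F, hF, rfl⟩
    have hd := eq_of_coeff_monomial_ne_zero hF
    refine ⟨fun x _ => ?_, fun x hx => ?_⟩
    · dsimp only
      split_ifs with h0
      · simp
      · rw [← hd]
        exact F.subset_content _ _ (by omega)
    · dsimp only
      split_ifs with h0
      · rfl
      · by_contra hne
        have hle := (F.nonempty_iff x.1 x.2).1 (Finset.nonempty_iff_ne_empty.2 hne)
        apply hx
        have hi : x.1 ∈ γ.support := by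
          rw [Finsupp.mem_support_iff]; omega
        exact Finset.mem_product.2 ⟨hi, Finset.mem_Icc.2 ⟨by omega,
          hle.trans (Finset.le_sup (f := γ) hi)⟩⟩
  · intro F _ F' _ h
    ext1
    funext i c
    rcases Nat.eq_zero_or_pos c with rfl | hc
    · rw [F.basement, F'.basement]
    · have := congrFun h (i, c)
      simpa [hc.ne'] using this

theorem locallyFinite_grothendieck {n : ℕ} (lam : n.Partition) :
    LocallyFiniteFamily fun T : SetRT (partitionDiagram lam) =>
      (MvPowerSeries.monomial T.content
        (Polynomial.X ^ (T.content.degree - n)) : GrothSeries) := by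
  classical
  intro d
  refine Set.Finite.of_finite_image
    (f := fun T (x : ℕ × ℕ) => T.entry x.1 x.2) ?_ ?_
  · refine (finite_setValued (partitionDiagram lam).cells d.support).subset ?_
    rintro _ ⟨T, hT, rfl⟩
    have hd := eq_of_coeff_monomial_ne_zero hT
    refine ⟨fun x _ => ?_, fun x hx => ?_⟩
    · rw [← hd]
      exact T.subset_content _ _
    · by_contra hne
      exact hx ((T.nonempty_iff x.1 x.2).1 (Finset.nonempty_iff_ne_empty.2 hne))
  · intro T _ T' _ h
    ext1
    funext i c
    exact congrFun h (i, c)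

theorem anchor_mem {A : Finset ℕ+} (h : A.Nonempty) : anchor A ∈ A := by
  obtain ⟨a, ha, h'⟩ := Finset.exists_mem_eq_sup A h id
  rw [anchor, h']; exact ha

/-- In a nonempty row `j` the anchor entry of the first box is `j`. -/
theorem SetSkyFill.anchor_first {γ : ℕ+ →₀ ℕ} (F : SetSkyFill γ) (j : ℕ+) (hj : 1 ≤ γ j) :
    anchor (F.entry j 1) = j := by
  have hmem := anchor_mem ((F.nonempty_iff j 1).2 hj)
  have hle : anchor (F.entry j 1) ≤ j :=
    F.row_weak j 0 j (by rw [F.basement]; simp) _ hmem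
  by_contra hne
  have hlt := lt_of_le_of_ne hle hne
  have hb : ∀ i, anchor (F.entry i 0) = i := fun i => by rw [F.basement]; simp [anchor]
  generalize hm : anchor (F.entry j 1) = m at *
  rcases le_or_gt (γ j) (γ m) with h | h
  · have := F.triple_A m j 0 hlt h (by omega)
    simp only [zero_add, hb, hm] at this
    rcases this with h | h
    · exact lt_irrefl _ h.1
    · exact absurd h.2 (not_lt.2 h.1)
  · have := F.triple_B m j 0 hlt h (by omega)
    simp only [zero_add, hb, hm] at this
    rcases this with h | h
    · exact lt_asymm h.1 hlt
    · exact lt_irrefl _ h.2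

theorem locallyFinite_quasiGrothendieck {n : ℕ} (α : Composition n) :
    LocallyFiniteFamily fun γ : {γ : ℕ+ →₀ ℕ // positivePart γ = α.blocks} =>
      lascouxAtom γ.1 := by
  classical
  intro d
  refine Set.Finite.of_finite_image (f := Subtype.val) ?_ Subtype.val_injective.injOn
  refine (Set.finite_Iic (∑ i ∈ d.support, (Finsupp.single i n : ℕ+ →₀ ℕ))).subset ?_
  rintro _ ⟨⟨γ, hγ⟩, hne, rfl⟩ i
  dsimp only
  by_cases hi : γ i = 0
  · rw [hi]; exact Nat.zero_le _
  · obtain ⟨F, hF⟩ : ∃ F : SetSkyFill γ, F.content = d := by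
      by_contra hno
      push Not at hno
      apply hne
      change ∑ᶠ F : SetSkyFill γ, _ = _
      refine finsum_eq_zero_of_forall_eq_zero fun F => ?_
      by_contra h
      exact hno F (eq_of_coeff_monomial_ne_zero h)
    have hi1 : 1 ≤ γ i := by omega
    have hid : i ∈ d.support := by
      rw [← hF]
      refine F.subset_content i 1 le_rfl ?_
      have := anchor_mem ((F.nonempty_iff i 1).2 hi1)
      rwa [F.anchor_first i hi1] at this
    have hmem : γ i ∈ α.blocks := by
      rw [← hγ, positivePart]
      exact List.mem_map.2 ⟨i, (Finset.mem_sort _).2 (Finsupp.mem_support_iff.2 hi), rfl⟩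
    have hn : γ i ≤ n := by
      rw [← α.blocks_sum]; exact List.le_sum_of_mem hmem
    have h1 : (Finsupp.single i n : ℕ+ →₀ ℕ) ≤ ∑ i ∈ d.support, Finsupp.single i n :=
      Finset.single_le_sum (f := fun i : ℕ+ => (Finsupp.single i n : ℕ+ →₀ ℕ))
        (fun _ _ => zero_le) hid
    have h2 := h1 i
    rw [Finsupp.single_eq_same] at h2
    exact hn.trans h2

/-! Forget the rows. From a reverse tableau, and equally from a skyline filling without its
basement, keep for every column only the set of its anchor entries and the set of all its entries.
Both kinds of object can be rebuilt from these sets, and the same families of sets arise from both.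
This gives a bijection, and it preserves content because no entry repeats in a column.

The families that arise are described by `ColumnData` through the numbers `countGE` alone. The
anchors of two neighbouring columns fit into weakly decreasing rows only if, for every `t`, the left
column has at least as many anchors `≥ t`. A free entry `m` fits into some row exactly when an
anchor exceeds `m` while its right neighbour is absent or at most `m`. By `IsColumn.countGE_lt_iff`
this is a strict inequality of counts, however the anchors are placed.

In a tableau, strict decrease down columns fixes the rows (`SetRT.columnData_bijective`). In a
skyline filling, the triple condition amounts to placing the anchors of each column in decreasing
order, each into the first row available (`SetSkyFill.greedy`), and (S4) sends every free entry to
the highest row that accepts it. Starting from the basement, the columns thus determine the filling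
and even its shape `γ` (`Greedy.unique`). Conversely, the counting conditions make the greedy
placement possible (`Greedy.exists`), and it satisfies all triple conditions. The column sizes say
that the nonzero parts of `γ` rearrange to the partition, so the fillings obtained are those of the
double sum over `α` and `γ`. -/

/-! ### Columns as sets, and their distributions over rows -/

/-- The number of elements of `A` that are at least `t`. -/
def countGE (A : Finset ℕ+) (t : ℕ) : ℕ := (A.filter fun a : ℕ+ => t ≤ (a : ℕ)).card

/-- The maximum of a set of positive integers, as a natural number; `0` for the empty set. -/
def maxEntry (A : Finset ℕ+) : ℕ := A.sup fun a => (a : ℕ)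

theorem le_maxEntry {A : Finset ℕ+} {a : ℕ+} (h : a ∈ A) : (a : ℕ) ≤ maxEntry A :=
  Finset.le_sup (f := fun a : ℕ+ => (a : ℕ)) h

theorem le_anchor {A : Finset ℕ+} {a : ℕ+} (h : a ∈ A) : a ≤ anchor A :=
  Finset.le_sup (f := id) h

theorem maxEntry_eq_anchor {A : Finset ℕ+} (h : A.Nonempty) : maxEntry A = (anchor A : ℕ) :=
  le_antisymm (Finset.sup_le fun _ ha => PNat.coe_le_coe _ _ |>.2 (le_anchor ha))
    (le_maxEntry (anchor_mem h))

theorem maxEntry_ne_zero {A : Finset ℕ+} : maxEntry A ≠ 0 ↔ A.Nonempty := by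
  constructor
  · intro h
    rw [Finset.nonempty_iff_ne_empty]
    rintro rfl
    exact h rfl
  · intro h
    rw [maxEntry_eq_anchor h]
    exact (anchor A).ne_zero

theorem maxEntry_mem {A : Finset ℕ+} {a : ℕ+} (h : maxEntry A = a) : a ∈ A := by
  have hA : A.Nonempty := maxEntry_ne_zero.1 (by rw [h]; exact a.ne_zero)
  rw [maxEntry_eq_anchor hA] at h
  rw [← PNat.coe_injective h]
  exact anchor_mem hA

/-- `f` lists the elements of `A`, each once, by the rows they are placed in; rows without an
element have the value `0`. -/
structure IsColumn {R : Type*} (f : R → ℕ) (A : Finset ℕ+) : Prop where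
  inj : ∀ i j, f i = f j → f i ≠ 0 → i = j
  mem_iff : ∀ a : ℕ+, a ∈ A ↔ ∃ i, f i = a

namespace IsColumn

variable {R : Type*} {f g : R → ℕ} {A B : Finset ℕ+}

theorem bijOn (h : IsColumn f A) {t : ℕ} (ht : t ≠ 0) :
    Set.BijOn f {i | t ≤ f i} ((fun a : ℕ+ => (a : ℕ)) '' (A.filter fun a : ℕ+ => t ≤ (a : ℕ))) := by
  refine ⟨?_, ?_, ?_⟩
  · intro i (hi : t ≤ f i)
    exact ⟨⟨f i, by omega⟩, Finset.mem_coe.2 (Finset.mem_filter.2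
      ⟨(h.mem_iff ⟨f i, by omega⟩).2 ⟨i, rfl⟩, hi⟩), rfl⟩
  · intro i (hi : t ≤ f i) j _ hij
    exact h.inj i j hij (by omega)
  · rintro _ ⟨a, ha, rfl⟩
    simp only [Finset.coe_filter, Set.mem_ofPred_eq] at ha
    obtain ⟨i, hi⟩ := (h.mem_iff a).1 ha.1
    exact ⟨i, by simpa [hi] using ha.2, hi⟩

theorem finite (h : IsColumn f A) {t : ℕ} (ht : t ≠ 0) : {i | t ≤ f i}.Finite :=
  ((h.bijOn ht).finite_iff_finite).2 ((Finset.finite_toSet _).image _)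

theorem ncard (h : IsColumn f A) {t : ℕ} (ht : t ≠ 0) : {i | t ≤ f i}.ncard = countGE A t := by
  rw [(h.bijOn ht).ncard_eq, Set.ncard_image_of_injective _ PNat.coe_injective,
    Set.ncard_coe_finset, countGE]

theorem countGE_le (hf : IsColumn f A) (hg : IsColumn g B) (h : ∀ i, g i ≤ f i) {t : ℕ}
    (ht : t ≠ 0) : countGE B t ≤ countGE A t := by
  rw [← hf.ncard ht, ← hg.ncard ht]
  exact Set.ncard_le_ncard (fun i (hi : t ≤ g i) => hi.trans (h i)) (hf.finite ht)

/-- The rows with `t < g i` are among the finitely many with `t < f i`, so the counts differ exactly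
when some row lies in the difference. The left side does not depend on the placement, which lets
free entries pass between tableaux and fillings. -/
theorem countGE_lt_iff (hf : IsColumn f A) (hg : IsColumn g B) (h : ∀ i, g i ≤ f i) (t : ℕ) :
    countGE B (t + 1) < countGE A (t + 1) ↔ ∃ i, g i ≤ t ∧ t < f i := by
  have ht : t + 1 ≠ 0 := by omega
  rw [← hf.ncard ht, ← hg.ncard ht]
  constructor
  · intro hlt
    by_contra! hno
    refine hlt.not_ge (Set.ncard_le_ncard (fun i (hi : t + 1 ≤ f i) => ?_) (hg.finite ht))
    by_contra hi'
    have := hno i (by simpa using hi')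
    omega
  · rintro ⟨i, hi, hi'⟩
    refine Set.ncard_lt_ncard ⟨fun i (hi : t + 1 ≤ g i) => hi.trans (h i), fun hsub => ?_⟩
      (hf.finite ht)
    have : t + 1 ≤ g i := hsub (show t + 1 ≤ f i from hi')
    omega

theorem card (h : IsColumn f A) : A.card = {i | f i ≠ 0}.ncard := by
  have : {i | f i ≠ 0} = {i | 1 ≤ f i} := by ext i; simp [Nat.one_le_iff_ne_zero]
  rw [this, h.ncard one_ne_zero, countGE, Finset.filter_true_of_mem]
  exact fun a _ => a.pos

end IsColumn

/-! ### Greedy placement of a column -/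

/-- The column `f` arises from the column `g` on its left by placing its elements, in decreasing
order, into the first row available. -/
def Greedy {R : Type*} [LT R] (g f : R → ℕ) : Prop :=
  ∀ i j, i < j → f j ≠ 0 → f j ≤ g i → f j < f i

/-- Take the largest element that the two placements put into different rows. The placement using
the lower row must have a larger element in the higher one; the other placement has that larger
element there too, yet also the element in question. -/
theorem Greedy.unique {R : Type*} [LinearOrder R] {g f f' : R → ℕ} {A : Finset ℕ+}
    (h : Greedy g f) (h' : Greedy g f') (hf : IsColumn f A) (hf' : IsColumn f' A)
    (hle : ∀ i, f i ≤ g i) (hle' : ∀ i, f' i ≤ g i) : f = f' := by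
  obtain ⟨N, hN⟩ : ∃ N, ∀ a ∈ A, (a : ℕ) ≤ N := ⟨maxEntry A, fun _ => le_maxEntry⟩
  -- Downward induction on the value: `k` bounds how far `f i` lies below the bound `N` of all
  -- entries, and `k = 0` is vacuous.
  have key : ∀ k, ∀ i i', f i ≠ 0 → N < f i + k → f i = f' i' → i = i' := by
    intro k
    induction k with
    | zero =>
      intro i _ h0 hlt _
      have := hN ⟨f i, by omega⟩ ((hf.mem_iff _).2 ⟨i, rfl⟩)
      simp at this
      omega
    | succ k ih =>
      intro i i' h0 hlt he
      rcases lt_trichotomy i i' with hii | hii | hii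
      · have hl := h' i i' hii (by omega) (by rw [← he]; exact hle i)
        obtain ⟨j, hj⟩ := (hf.mem_iff ⟨f' i, by omega⟩).1 ((hf'.mem_iff _).2 ⟨i, rfl⟩)
        simp only [PNat.mk_coe] at hj
        have := ih j i (by omega) (by omega) hj
        subst this
        omega
      · exact hii
      · have hl := h i' i hii (by omega) (by rw [he]; exact hle' i')
        obtain ⟨j, hj⟩ := (hf'.mem_iff ⟨f i', by omega⟩).1 ((hf.mem_iff _).2 ⟨i', rfl⟩)
        simp only [PNat.mk_coe] at hj
        have := ih i' j (by omega) (by omega) hj.symm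
        subst this
        omega
  funext i
  by_cases h0 : f i = 0
  · by_contra hne
    obtain ⟨j, hj⟩ := (hf.mem_iff ⟨f' i, by omega⟩).1 ((hf'.mem_iff _).2 ⟨i, rfl⟩)
    simp only [PNat.mk_coe] at hj
    have := key (N + 1) j i (by omega) (by omega) hj
    subst this
    omega
  · obtain ⟨j, hj⟩ := (hf'.mem_iff ⟨f i, by omega⟩).1 ((hf.mem_iff _).2 ⟨i, rfl⟩)
    simp only [PNat.mk_coe] at hj
    rw [key (N + 1) i j h0 (by omega) hj.symm, hj, key (N + 1) i j h0 (by omega) hj.symm]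

/-- Elements are placed from the largest to the smallest, each into the first empty row whose left
neighbour permits it. The counting hypothesis is a Hall condition for nested sets of rows. -/
theorem Greedy.exists {R : Type*} [LinearOrder R] [WellFoundedLT R] {g : R → ℕ}
    (hfin : ∀ t ≠ 0, {i | t ≤ g i}.Finite) (A : Finset ℕ+)
    (hA : ∀ t ≠ 0, countGE A t ≤ {i | t ≤ g i}.ncard) :
    ∃ f : R → ℕ, IsColumn f A ∧ (∀ i, f i ≤ g i) ∧ Greedy g f := by
  classical
  induction A using Finset.induction_on_min with
  | empty => exact ⟨fun _ => 0, ⟨by simp, by simp [fun a : ℕ+ => a.ne_zero.symm]⟩, by simp,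
      fun _ _ _ h => by simp at h⟩
  | insert x A hx ih =>
    obtain ⟨f, hf, hle, hgr⟩ := ih fun t ht =>
      (Finset.card_le_card (Finset.filter_subset_filter _ (Finset.subset_insert _ _))).trans
        (hA t ht)
    have hfx : ∀ i, f i ≠ 0 → (x : ℕ) < f i := fun i hi =>
      PNat.coe_lt_coe _ _ |>.2 (hx ⟨f i, by omega⟩ ((hf.mem_iff _).2 ⟨i, rfl⟩))
    -- If every row with `x ≤ g i` were occupied, there would be at most `A.card` such rows, against
    -- the hypothesis at `t = x`, where `insert x A` counts `A.card + 1`.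
    have hex : ∃ i, f i = 0 ∧ (x : ℕ) ≤ g i := by
      by_contra! hno
      have h1 := hA x x.ne_zero
      have h2 : {i | (x : ℕ) ≤ g i} ⊆ {i | f i ≠ 0} := fun i (hi : (x : ℕ) ≤ g i) h0 =>
        (hno i h0).not_ge hi
      have h3 : {i | f i ≠ 0}.Finite :=
        (hfin x x.ne_zero).subset fun i hi => (hfx i hi).le.trans (hle i)
      have h4 := Set.ncard_le_ncard h2 h3
      rw [← hf.card] at h4
      have h5 : countGE (insert x A) x = A.card + 1 := by
        rw [countGE, Finset.filter_true_of_mem, Finset.card_insert_of_notMem]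
        · exact fun h => lt_irrefl _ (hx x h)
        · intro a ha
          rcases Finset.mem_insert.1 ha with rfl | ha
          · exact le_rfl
          · exact PNat.coe_le_coe _ _ |>.2 (hx a ha).le
      omega
    obtain ⟨r, ⟨hr0, hrx⟩, hmin⟩ := WellFounded.has_min (wellFounded_lt (α := R))
      {i | f i = 0 ∧ (x : ℕ) ≤ g i} hex
    have hx0 := x.pos
    refine ⟨Function.update f r x, ⟨?_, ?_⟩, ?_, ?_⟩
    · intro i j hij h0
      simp only [Function.update_apply] at hij h0
      split_ifs at hij h0 with hi hj hj
      · rw [hi, hj]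
      · have := hfx j (by omega); omega
      · have := hfx i h0; omega
      · exact hf.inj i j hij h0
    · intro a
      rw [Finset.mem_insert, hf.mem_iff]
      constructor
      · rintro (rfl | ⟨i, hi⟩)
        · exact ⟨r, by simp⟩
        · refine ⟨i, ?_⟩
          rw [Function.update_of_ne, hi]
          rintro rfl
          exact a.ne_zero (hi.symm.trans hr0)
      · rintro ⟨i, hi⟩
        rw [Function.update_apply] at hi
        split_ifs at hi with h
        · exact Or.inl (PNat.coe_injective hi.symm)
        · exact Or.inr ⟨i, hi⟩
    · intro i
      rw [Function.update_apply]
      split_ifs with h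
      · rwa [h]
      · exact hle i
    · intro i j hij h0 hjg
      simp only [Function.update_apply] at h0 hjg ⊢
      split_ifs at h0 hjg ⊢ with hj hi hi
      · exact absurd hij (by rw [hi, hj]; exact lt_irrefl _)
      · apply hfx
        intro hi0
        exact hmin i ⟨hi0, hjg⟩ (hj ▸ hij)
      · have := hgr i j hij h0 hjg
        rw [hi, hr0] at this
        omega
      · exact hgr i j hij h0 hjg

/-! ### Column data and reverse tableaux -/

/-- For every column of a set-valued tableau, its set of anchor entries and the set of all its
entries. -/
@[ext] structure ColumnData (μ : YoungDiagram) where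
  anchors : ℕ → Finset ℕ+
  all : ℕ → Finset ℕ+
  subset : ∀ c, anchors c ⊆ all c
  card : ∀ c, (anchors c).card = μ.colLen c
  dominance : ∀ c t, t ≠ 0 → countGE (anchors (c + 1)) t ≤ countGE (anchors c) t
  -- The threshold `m + 1` makes this say that some row has its anchor above `m` and its right
  -- neighbour at most `m`, with `0` for an absent neighbour.
  free : ∀ c, ∀ m ∈ all c, m ∉ anchors c →
    countGE (anchors (c + 1)) (m + 1) < countGE (anchors c) (m + 1)

namespace SetRT

variable {μ : YoungDiagram} (T : SetRT μ)

theorem lt_of_row_lt {i i' j : ℕ} (h : i < i') {a b : ℕ+} (ha : a ∈ T.entry i j)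
    (hb : b ∈ T.entry i' j) : b < a := by
  induction i', h using Nat.le_induction generalizing b with
  | base => exact T.column_strict i j a ha b hb
  | succ k hk ih =>
    have hmem : (k, j) ∈ μ := μ.up_left_mem k.le_succ le_rfl ((T.nonempty_iff _ _).1 ⟨b, hb⟩)
    obtain ⟨c, hc⟩ := (T.nonempty_iff _ _).2 hmem
    exact (T.column_strict k j c hc b hb).trans (ih hc)

theorem row_eq {i i' j : ℕ} {a : ℕ+} (ha : a ∈ T.entry i j) (ha' : a ∈ T.entry i' j) :
    i = i' := by
  rcases lt_trichotomy i i' with h | h | h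
  · exact absurd (T.lt_of_row_lt h ha ha') (lt_irrefl _)
  · exact h
  · exact absurd (T.lt_of_row_lt h ha' ha) (lt_irrefl _)

/-- The anchor entries of column `c`. -/
def anchors (c : ℕ) : Finset ℕ+ :=
  (Finset.range (μ.colLen c)).image fun i => anchor (T.entry i c)

/-- The entries of column `c`. -/
def all (c : ℕ) : Finset ℕ+ :=
  (Finset.range (μ.colLen c)).biUnion fun i => T.entry i c

theorem lt_colLen {i c : ℕ} {m : ℕ+} (h : m ∈ T.entry i c) : i < μ.colLen c :=
  YoungDiagram.mem_iff_lt_colLen.1 ((T.nonempty_iff _ _).1 ⟨m, h⟩)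

theorem mem_all {c : ℕ} {m : ℕ+} : m ∈ T.all c ↔ ∃ i, m ∈ T.entry i c := by
  simp only [all, Finset.mem_biUnion, Finset.mem_range]
  exact ⟨fun ⟨i, _, h⟩ => ⟨i, h⟩, fun ⟨i, h⟩ => ⟨i, T.lt_colLen h, h⟩⟩

theorem isColumn (c : ℕ) : IsColumn (fun i => maxEntry (T.entry i c)) (T.anchors c) where
  inj i j h h0 := by
    have hi := maxEntry_ne_zero.1 h0
    have hj := maxEntry_ne_zero.1 (h ▸ h0)
    rw [maxEntry_eq_anchor hi, maxEntry_eq_anchor hj] at h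
    refine T.row_eq (anchor_mem hi) ?_
    rw [PNat.coe_injective h]
    exact anchor_mem hj
  mem_iff a := by
    simp only [anchors, Finset.mem_image, Finset.mem_range]
    constructor
    · rintro ⟨i, hi, rfl⟩
      exact ⟨i, maxEntry_eq_anchor
        ((T.nonempty_iff _ _).2 (YoungDiagram.mem_iff_lt_colLen.2 hi))⟩
    · rintro ⟨i, hi⟩
      have hmem := maxEntry_mem hi
      refine ⟨i, T.lt_colLen hmem, PNat.coe_injective ?_⟩
      rw [← hi, maxEntry_eq_anchor ⟨a, hmem⟩]

theorem maxEntry_le (i c : ℕ) {m : ℕ+} (h : m ∈ T.entry i c) :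
    maxEntry (T.entry i (c + 1)) ≤ m :=
  Finset.sup_le fun b hb => T.row_weak i c m h b hb

theorem maxEntry_succ_le (i c : ℕ) : maxEntry (T.entry i (c + 1)) ≤ maxEntry (T.entry i c) := by
  by_cases h : (T.entry i (c + 1)).Nonempty
  · have : (T.entry i c).Nonempty := (T.nonempty_iff _ _).2
      (μ.up_left_mem le_rfl c.le_succ ((T.nonempty_iff _ _).1 h))
    obtain ⟨m, hm⟩ := this
    exact (T.maxEntry_le i c hm).trans (le_maxEntry hm)
  · rw [Finset.not_nonempty_iff_eq_empty.1 h]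
    exact Nat.zero_le _

theorem mem_anchors_iff {i c : ℕ} {m : ℕ+} (h : m ∈ T.entry i c) :
    m ∈ T.anchors c ↔ (m : ℕ) = maxEntry (T.entry i c) := by
  rw [(T.isColumn c).mem_iff]
  constructor
  · rintro ⟨j, hj⟩
    rw [T.row_eq h (maxEntry_mem hj), hj]
  · exact fun h => ⟨i, h.symm⟩

/-- The columns of a set-valued reverse tableau. -/
def columnData : ColumnData μ where
  anchors := T.anchors
  all := T.all
  subset c a ha := by
    obtain ⟨i, hi⟩ := ((T.isColumn c).mem_iff a).1 ha
    exact T.mem_all.2 ⟨i, maxEntry_mem hi⟩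
  card c := by
    rw [anchors, Finset.card_image_of_injOn, Finset.card_range]
    intro i hi j hj h
    have key : ∀ i ∈ Finset.range (μ.colLen c), anchor (T.entry i c) ∈ T.entry i c := fun i hi =>
      anchor_mem ((T.nonempty_iff _ _).2
        (YoungDiagram.mem_iff_lt_colLen.2 (Finset.mem_range.1 hi)))
    have h1 := key i hi
    rw [show anchor (T.entry i c) = anchor (T.entry j c) from h] at h1
    exact T.row_eq h1 (key j hj)
  dominance c t ht :=
    (T.isColumn c).countGE_le (T.isColumn (c + 1)) (fun i => T.maxEntry_succ_le i c) ht
  free c m hm hna := by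
    obtain ⟨i, hi⟩ := T.mem_all.1 hm
    refine ((T.isColumn c).countGE_lt_iff (T.isColumn (c + 1))
      (fun i => T.maxEntry_succ_le i c) m).2 ⟨i, T.maxEntry_le i c hi, ?_⟩
    exact lt_of_le_of_ne (le_maxEntry hi) fun h => hna ((T.mem_anchors_iff hi).2 h)

/-- All entries in higher rows of the column are larger and all in lower rows smaller, so the
anchors that are at least `m` are those of rows `0, …, i`. The row of an entry is therefore read off
from the anchor set. -/
theorem countGE_anchors {i c : ℕ} {m : ℕ+} (h : m ∈ T.entry i c) :
    countGE (T.anchors c) m = i + 1 := by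
  rw [← (T.isColumn c).ncard m.ne_zero]
  have : {j | (m : ℕ) ≤ maxEntry (T.entry j c)} = (Finset.range (i + 1) : Set ℕ) := by
    ext j
    simp only [Finset.coe_range, Set.mem_Iio, Set.mem_ofPred_eq]
    constructor
    · intro hj
      by_contra! hij
      have hne : (T.entry j c).Nonempty := maxEntry_ne_zero.1 (by have := m.pos; omega)
      have := T.lt_of_row_lt (by omega) h (anchor_mem hne)
      rw [maxEntry_eq_anchor hne] at hj
      exact hj.not_gt this
    · intro hj
      rcases (Nat.lt_succ_iff.1 hj).eq_or_lt with rfl | hj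
      · exact le_maxEntry h
      · have hne : (T.entry j c).Nonempty := (T.nonempty_iff _ _).2
          (μ.up_left_mem hj.le le_rfl ((T.nonempty_iff _ _).1 ⟨m, h⟩))
        rw [maxEntry_eq_anchor hne]
        exact (T.lt_of_row_lt hj (anchor_mem hne) h).le
  rw [this, Set.ncard_coe_finset, Finset.card_range]

theorem mem_entry_iff {i c : ℕ} {m : ℕ+} :
    m ∈ T.entry i c ↔ m ∈ T.all c ∧ countGE (T.anchors c) m = i + 1 := by
  refine ⟨fun h => ⟨T.mem_all.2 ⟨i, h⟩, T.countGE_anchors h⟩, ?_⟩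
  rintro ⟨h, hi⟩
  obtain ⟨j, hj⟩ := T.mem_all.1 h
  have := T.countGE_anchors hj
  obtain rfl : i = j := by omega
  exact hj

theorem columnData_injective : Function.Injective (columnData (μ := μ)) := by
  intro T T' h
  have h1 : T.anchors = T'.anchors := congrArg ColumnData.anchors h
  have h2 : T.all = T'.all := congrArg ColumnData.all h
  ext i c m
  rw [mem_entry_iff, mem_entry_iff, h1, h2]

theorem content_apply (m : ℕ+) : T.content m = {c | m ∈ T.all c}.ncard := by
  have h1 : T.content m = (μ.cells.filter fun x => m ∈ T.entry x.1 x.2).card := by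
    simp only [content, Finsupp.finsetSum_apply, Finsupp.single_apply, Finset.sum_ite_eq',
      Finset.card_filter]
  have h2 : {c | m ∈ T.all c} =
      ↑((μ.cells.filter fun x => m ∈ T.entry x.1 x.2).image Prod.snd) := by
    ext c
    simp only [Set.mem_ofPred_eq, mem_all, Finset.coe_image, Set.mem_image, Finset.coe_filter,
      Prod.exists, exists_eq_right]
    refine exists_congr fun i => ⟨fun h => ⟨(T.nonempty_iff _ _).1 ⟨m, h⟩, h⟩, fun h => h.2⟩
  rw [h1, h2, Set.ncard_coe_finset, Finset.card_image_of_injOn]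
  rintro ⟨i, c⟩ hi ⟨j, c'⟩ hj h
  obtain rfl : c = c' := h
  exact congrArg (·, c) (T.row_eq (Finset.mem_filter.1 hi).2 (Finset.mem_filter.1 hj).2)

end SetRT

theorem countGE_anti (A : Finset ℕ+) {s t : ℕ} (h : s ≤ t) : countGE A t ≤ countGE A s :=
  Finset.card_le_card fun _ ha => Finset.mem_filter.2
    ⟨(Finset.mem_filter.1 ha).1, h.trans (Finset.mem_filter.1 ha).2⟩

theorem countGE_le_card (A : Finset ℕ+) (t : ℕ) : countGE A t ≤ A.card :=
  Finset.card_filter_le _ _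

theorem countGE_of_mem {A : Finset ℕ+} {a : ℕ+} (h : a ∈ A) :
    countGE A a = countGE A (a + 1) + 1 := by
  have : (A.filter fun b : ℕ+ => (a : ℕ) ≤ (b : ℕ)) =
      insert a (A.filter fun b : ℕ+ => (a : ℕ) + 1 ≤ (b : ℕ)) := by
    ext b
    simp only [Finset.mem_filter, Finset.mem_insert]
    constructor
    · rintro ⟨hb, hab⟩
      rcases hab.eq_or_lt with he | hl
      · exact Or.inl (PNat.coe_injective he.symm)
      · exact Or.inr ⟨hb, hl⟩
    · rintro (rfl | ⟨hb, hab⟩)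
      · exact ⟨h, le_rfl⟩
      · exact ⟨hb, by omega⟩
  rw [countGE, this, Finset.card_insert_of_notMem (by simp), countGE]

theorem countGE_of_notMem {A : Finset ℕ+} {a : ℕ+} (h : a ∉ A) :
    countGE A a = countGE A (a + 1) := by
  rw [countGE, countGE]
  congr 1
  refine Finset.filter_congr fun b hb => ⟨fun hab => ?_, fun hab => by omega⟩
  exact lt_of_le_of_ne hab fun he => h (PNat.coe_injective he ▸ hb)

/-- Along the elements in decreasing order the count runs through `1, …, A.card`. This makes the
boxes of `ColumnData.toSetRT` nonempty. -/
theorem exists_countGE_eq (A : Finset ℕ+) {i : ℕ} (h : i < A.card) :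
    ∃ a ∈ A, countGE A a = i + 1 := by
  induction A using Finset.induction_on_min generalizing i with
  | empty => simp at h
  | insert x A hx ih =>
    have hxA : x ∉ A := fun h => lt_irrefl _ (hx x h)
    rw [Finset.card_insert_of_notMem hxA] at h
    rcases (Nat.lt_succ_iff.1 h).eq_or_lt with rfl | hi
    · refine ⟨x, Finset.mem_insert_self _ _, ?_⟩
      rw [countGE, Finset.filter_true_of_mem, Finset.card_insert_of_notMem hxA]
      intro a ha
      rcases Finset.mem_insert.1 ha with rfl | ha
      · exact le_rfl
      · exact PNat.coe_le_coe _ _ |>.2 (hx a ha).le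
    · obtain ⟨a, ha, he⟩ := ih hi
      refine ⟨a, Finset.mem_insert_of_mem ha, ?_⟩
      rw [← he, countGE, countGE, Finset.filter_insert, if_neg]
      exact (PNat.coe_lt_coe _ _ |>.2 (hx a ha)).not_ge

namespace ColumnData

variable {μ : YoungDiagram} (D : ColumnData μ)

theorem countGE_pos {c : ℕ} {m : ℕ+} (h : m ∈ D.all c) : 0 < countGE (D.anchors c) m := by
  by_cases ha : m ∈ D.anchors c
  · rw [countGE_of_mem ha]; omega
  · rw [countGE_of_notMem ha]
    exact (Nat.zero_le _).trans_lt (D.free c m h ha)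

/-- The set-valued reverse tableau with given columns. -/
def toSetRT : SetRT μ where
  entry i c := (D.all c).filter fun m => countGE (D.anchors c) m = i + 1
  nonempty_iff i c := by
    rw [YoungDiagram.mem_iff_lt_colLen, ← D.card]
    constructor
    · rintro ⟨m, hm⟩
      have := (Finset.mem_filter.1 hm).2
      have := countGE_le_card (D.anchors c) m
      omega
    · intro h
      obtain ⟨a, ha, he⟩ := exists_countGE_eq _ h
      exact ⟨a, Finset.mem_filter.2 ⟨D.subset c ha, he⟩⟩
  row_weak i c a ha b hb := by
    rw [Finset.mem_filter] at ha hb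
    -- If `a < b`, then at least `i + 1` anchors on either side are `≥ a + 1`. An anchor `a` would
    -- be one more on the left; a free `a` needs strictly more on the left than on the right. Both
    -- contradict that exactly `i + 1` left anchors are `≥ a`.
    by_contra! hlt
    have h1 := countGE_anti (D.anchors (c + 1)) (s := a + 1) (t := b) hlt
    have h2 := countGE_anti (D.anchors c) (s := a + 1) (t := b) hlt
    have h3 := D.dominance c b b.ne_zero
    by_cases hm : a ∈ D.anchors c
    · have := countGE_of_mem hm
      omega
    · have := countGE_of_notMem hm
      have := D.free c a ha.1 hm
      omega
  column_strict i c a ha b hb := by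
    rw [Finset.mem_filter] at ha hb
    by_contra! hle
    have := countGE_anti (D.anchors c) (s := a) (t := b) hle
    omega

theorem toSetRT_all (c : ℕ) : D.toSetRT.all c = D.all c := by
  ext m
  rw [SetRT.mem_all]
  constructor
  · rintro ⟨i, hi⟩
    exact (Finset.mem_filter.1 hi).1
  · intro h
    refine ⟨countGE (D.anchors c) m - 1, Finset.mem_filter.2 ⟨h, ?_⟩⟩
    have := D.countGE_pos h
    omega

/-- The count drops by one just above an anchor, so nothing larger shares its box and it is the
maximum there. Equal cardinalities give the other inclusion. -/
theorem toSetRT_anchors (c : ℕ) : D.toSetRT.anchors c = D.anchors c := by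
  refine (Finset.eq_of_subset_of_card_le (fun a ha => ?_) ?_).symm
  · have hm := D.subset c ha
    rw [← toSetRT_all, SetRT.mem_all] at hm
    obtain ⟨i, hi⟩ := hm
    rw [SetRT.mem_anchors_iff _ hi]
    refine le_antisymm (le_maxEntry hi) (Finset.sup_le fun b hb => ?_)
    by_contra! hlt
    have h1 := countGE_anti (D.anchors c) (s := a + 1) (t := b) hlt
    have h2 := countGE_of_mem ha
    have h3 := (Finset.mem_filter.1 hi).2
    have h4 := (Finset.mem_filter.1 hb).2
    omega
  · rw [D.card]
    exact (D.toSetRT.columnData.card c).le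

end ColumnData

theorem SetRT.columnData_bijective (μ : YoungDiagram) :
    Function.Bijective (columnData (μ := μ)) :=
  ⟨columnData_injective, fun D => ⟨D.toSetRT,
    ColumnData.ext (funext D.toSetRT_anchors) (funext D.toSetRT_all)⟩⟩

/-! ### Skyline fillings are determined by their columns -/

/-- For greedily placed columns, a shorter row above a longer one has the smaller entries; this
relates the greedy condition to inversion triples of type B. -/
theorem Greedy.lt_of_shorter {R : Type*} [LT R] {f : ℕ → R → ℕ} {γ : R → ℕ}
    (hγ : ∀ i c, f c i ≠ 0 ↔ c ≤ γ i) (hle : ∀ c i, f (c + 1) i ≤ f c i)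
    (hg : ∀ c, Greedy (f c) (f (c + 1))) {i j : R} (hij : i < j) (hlt : γ i < γ j) {k : ℕ}
    (hk : k ≤ γ i) : f k i < f (k + 1) j := by
  -- Induction starts at the end of row `i`: there the greedy condition would force an entry into
  -- the missing box `(i, γ i + 1)`. A failure further left moves one column to the right, against
  -- the induction hypothesis.
  induction hk using Nat.decreasingInduction with
  | self =>
    by_contra! h
    have h1 := hg _ i j hij ((hγ j (γ i + 1)).2 hlt) h
    have h2 := (hγ i (γ i + 1)).1 (by omega)
    omega
  | of_succ k hk ih =>
    by_contra! h
    have h1 := hg _ i j hij ((hγ j (k + 1)).2 (by omega)) h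
    have := hle (k + 1) j
    omega

namespace SetSkyFill

variable {γ : ℕ+ →₀ ℕ} (F : SetSkyFill γ)

theorem maxEntry_ne_zero_iff (i : ℕ+) (c : ℕ) : maxEntry (F.entry i c) ≠ 0 ↔ c ≤ γ i := by
  rw [maxEntry_ne_zero, F.nonempty_iff]

theorem maxEntry_eq (i : ℕ+) {c : ℕ} (h : c ≤ γ i) :
    maxEntry (F.entry i c) = (anchor (F.entry i c) : ℕ) :=
  maxEntry_eq_anchor ((F.nonempty_iff _ _).2 h)

theorem maxEntry_basement (i : ℕ+) : maxEntry (F.entry i 0) = i := by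
  rw [F.basement, maxEntry, Finset.sup_singleton]

theorem row_eq {i j : ℕ+} {c : ℕ} {m : ℕ+} (hi : m ∈ F.entry i c) (hj : m ∈ F.entry j c) :
    i = j := by
  by_contra h
  exact Finset.disjoint_left.1 (F.column_disjoint i j c h) hi hj

theorem maxEntry_le (i : ℕ+) (c : ℕ) {m : ℕ+} (h : m ∈ F.entry i c) :
    maxEntry (F.entry i (c + 1)) ≤ m :=
  Finset.sup_le fun b hb => F.row_weak i c m h b hb

theorem maxEntry_succ_le (c : ℕ) (i : ℕ+) :
    maxEntry (F.entry i (c + 1)) ≤ maxEntry (F.entry i c) := by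
  by_cases h : c + 1 ≤ γ i
  · obtain ⟨m, hm⟩ := (F.nonempty_iff i c).2 (by omega)
    exact (F.maxEntry_le i c hm).trans (le_maxEntry hm)
  · rw [← F.maxEntry_ne_zero_iff, not_not] at h
    omega

theorem maxEntry_injective {i j : ℕ+} {c : ℕ}
    (h : maxEntry (F.entry i c) = maxEntry (F.entry j c)) (h0 : maxEntry (F.entry i c) ≠ 0) :
    i = j := by
  have hj := (F.maxEntry_ne_zero_iff j c).1 (h ▸ h0)
  have hi := (F.maxEntry_ne_zero_iff i c).1 h0
  refine F.row_eq (maxEntry_mem (F.maxEntry_eq i hi)) ?_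
  rw [F.maxEntry_eq i hi, F.maxEntry_eq j hj] at h
  rw [PNat.coe_injective h]
  exact maxEntry_mem (F.maxEntry_eq j hj)

/-- True in the basement. Given it in column `k`, the type B triple leaves only the case that `(i,
k)` is smaller than `(j, k + 1)`, and row `i` decreases weakly. -/
theorem lt_of_shorter {i j : ℕ+} (hij : i < j) (hlt : γ i < γ j) {k : ℕ} (hk : k ≤ γ i) :
    maxEntry (F.entry i k) < maxEntry (F.entry j k) := by
  induction k with
  | zero =>
    rw [F.maxEntry_basement, F.maxEntry_basement]
    exact PNat.coe_lt_coe _ _ |>.2 hij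
  | succ k ih =>
    have h1 := ih (by omega)
    have h2 := F.triple_B i j k hij hlt (by omega)
    simp only [IsInversionTriple, ← PNat.coe_lt_coe, ← PNat.coe_le_coe] at h2
    rw [← F.maxEntry_eq _ (by omega), ← F.maxEntry_eq _ (by omega),
      ← F.maxEntry_eq _ (by omega)] at h2
    have h3 := F.maxEntry_succ_le k i
    omega

theorem greedy (c : ℕ) :
    Greedy (fun i => maxEntry (F.entry i c)) fun i => maxEntry (F.entry i (c + 1)) := by
  intro i j hij h0 hle
  dsimp only at h0 hle ⊢
  have hj := (F.maxEntry_ne_zero_iff j (c + 1)).1 h0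
  have hi := (F.maxEntry_ne_zero_iff i c).1 (by omega)
  rcases le_or_gt (γ j) (γ i) with h | h
  · have h2 := F.triple_A i j c hij h hj
    simp only [IsInversionTriple, ← PNat.coe_lt_coe, ← PNat.coe_le_coe] at h2
    rw [← F.maxEntry_eq _ (by omega), ← F.maxEntry_eq _ (by omega),
      ← F.maxEntry_eq _ (by omega)] at h2
    omega
  -- For a shorter row above a longer one the greedy condition is vacuous: the triple makes `(j, c +
  -- 1)` exceed `(i, c)`.
  · have h1 := F.lt_of_shorter hij h hi
    have h2 := F.triple_B i j c hij h hi
    simp only [IsInversionTriple, ← PNat.coe_lt_coe, ← PNat.coe_le_coe] at h2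
    rw [← F.maxEntry_eq _ (by omega), ← F.maxEntry_eq _ (by omega),
      ← F.maxEntry_eq _ (by omega)] at h2
    omega

/-- The anchor entries of column `c + 1`. -/
def anchors (c : ℕ) : Finset ℕ+ :=
  (γ.support.filter fun i => c < γ i).image fun i => anchor (F.entry i (c + 1))

/-- The entries of column `c + 1`. -/
def all (c : ℕ) : Finset ℕ+ := γ.support.biUnion fun i => F.entry i (c + 1)

theorem le_of_mem {i : ℕ+} {c : ℕ} {m : ℕ+} (h : m ∈ F.entry i c) : c ≤ γ i :=
  (F.nonempty_iff _ _).1 ⟨m, h⟩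

theorem mem_all {c : ℕ} {m : ℕ+} : m ∈ F.all c ↔ ∃ i, m ∈ F.entry i (c + 1) := by
  simp only [all, Finset.mem_biUnion, Finsupp.mem_support_iff]
  exact exists_congr fun i => ⟨fun h => h.2, fun h => ⟨by have := F.le_of_mem h; omega, h⟩⟩

theorem isColumn (c : ℕ) :
    IsColumn (fun i => maxEntry (F.entry i (c + 1))) (F.anchors c) where
  inj _ _ h h0 := F.maxEntry_injective h h0
  mem_iff a := by
    simp only [anchors, Finset.mem_image, Finset.mem_filter, Finsupp.mem_support_iff]
    constructor
    · rintro ⟨i, ⟨_, hi⟩, rfl⟩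
      exact ⟨i, F.maxEntry_eq i hi⟩
    · rintro ⟨i, hi⟩
      have h := F.le_of_mem (maxEntry_mem hi)
      refine ⟨i, ⟨by omega, h⟩, PNat.coe_injective ?_⟩
      rw [← hi, F.maxEntry_eq i h]

theorem mem_anchors_iff {i : ℕ+} {c : ℕ} {m : ℕ+} (h : m ∈ F.entry i (c + 1)) :
    m ∈ F.anchors c ↔ (m : ℕ) = maxEntry (F.entry i (c + 1)) := by
  rw [(F.isColumn c).mem_iff]
  constructor
  · rintro ⟨j, hj⟩
    rw [F.row_eq h (maxEntry_mem hj), hj]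
  · exact fun h => ⟨i, h.symm⟩

theorem lt_maxEntry_of_notMem {i : ℕ+} {c : ℕ} {m : ℕ+} (h : m ∈ F.entry i (c + 1))
    (hna : m ∉ F.anchors c) : (m : ℕ) < maxEntry (F.entry i (c + 1)) :=
  lt_of_le_of_ne (le_maxEntry h) fun he => hna ((F.mem_anchors_iff h).2 he)

theorem card_anchors (c : ℕ) : (F.anchors c).card = (γ.support.filter fun i => c < γ i).card := by
  refine Finset.card_image_of_injOn fun i hi j hj h => ?_
  have hi := (Finset.mem_filter.1 hi).2
  have hj := (Finset.mem_filter.1 hj).2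
  refine F.maxEntry_injective (c := c + 1) ?_ ((F.maxEntry_ne_zero_iff _ _).2 hi)
  rw [F.maxEntry_eq i hi, F.maxEntry_eq j hj]
  exact congrArg PNat.val h

/-- The columns of a skyline filling. -/
def columnData {μ : YoungDiagram}
    (h : ∀ c, (γ.support.filter fun i => c < γ i).card = μ.colLen c) : ColumnData μ where
  anchors := F.anchors
  all := F.all
  subset c a ha := by
    obtain ⟨i, hi⟩ := ((F.isColumn c).mem_iff a).1 ha
    exact F.mem_all.2 ⟨i, maxEntry_mem hi⟩
  card c := by rw [F.card_anchors, h]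
  dominance c t ht :=
    (F.isColumn c).countGE_le (F.isColumn (c + 1)) (F.maxEntry_succ_le (c + 1)) ht
  free c m hm hna := by
    obtain ⟨i, hi⟩ := F.mem_all.1 hm
    exact ((F.isColumn c).countGE_lt_iff (F.isColumn (c + 1)) (F.maxEntry_succ_le (c + 1)) m).2
      ⟨i, F.maxEntry_le i (c + 1) hi, F.lt_maxEntry_of_notMem hi hna⟩

/-- A free entry could sit in any row of the displayed set, and (S4) forces the highest one. The set
refers only to anchors, so these fix the rows of the free entries. -/
theorem mem_entry_imp {i : ℕ+} {c : ℕ} {m : ℕ+} (h : m ∈ F.entry i (c + 1)) :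
    (m : ℕ) = maxEntry (F.entry i (c + 1)) ∨ m ∉ F.anchors c ∧ IsLeast {j |
      maxEntry (F.entry j (c + 2)) ≤ m ∧ (m : ℕ) < maxEntry (F.entry j (c + 1))} i := by
  by_cases hm : m ∈ F.anchors c
  · exact Or.inl ((F.mem_anchors_iff h).1 hm)
  · refine Or.inr ⟨hm, ⟨F.maxEntry_le i (c + 1) h, F.lt_maxEntry_of_notMem h hm⟩, ?_⟩
    rintro j ⟨hj, hj'⟩
    by_contra! hji
    have hne := F.le_of_mem h
    have hjne := (F.maxEntry_ne_zero_iff j (c + 1)).1 (by omega)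
    refine F.free_highest i (c + 1) m h (fun he => ?_) j hji hjne ⟨?_, fun b hb => ?_⟩
    · refine hm ((F.mem_anchors_iff h).2 ?_)
      rw [F.maxEntry_eq i hne, ← he]
    · rwa [F.maxEntry_eq j hjne, PNat.coe_lt_coe] at hj'
    · exact PNat.coe_le_coe _ _ |>.1 ((le_maxEntry hb).trans hj)

theorem mem_entry_iff {i : ℕ+} {c : ℕ} {m : ℕ+} : m ∈ F.entry i (c + 1) ↔ m ∈ F.all c ∧
    ((m : ℕ) = maxEntry (F.entry i (c + 1)) ∨ m ∉ F.anchors c ∧ IsLeast {j |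
      maxEntry (F.entry j (c + 2)) ≤ m ∧ (m : ℕ) < maxEntry (F.entry j (c + 1))} i) := by
  refine ⟨fun h => ⟨F.mem_all.2 ⟨i, h⟩, F.mem_entry_imp h⟩, ?_⟩
  rintro ⟨hm, h⟩
  obtain ⟨j, hj⟩ := F.mem_all.1 hm
  rcases h with h | ⟨h, hi⟩
  · exact maxEntry_mem h.symm
  · rcases F.mem_entry_imp hj with h' | ⟨_, hj'⟩
    · exact absurd ((F.mem_anchors_iff hj).2 h') h
    · rwa [hi.unique hj']

/-- The basement is common to all shapes, and each further column is the unique greedy placement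
against the previous one. The shapes need not agree in advance, which yields `shape_unique`. -/
theorem maxEntry_unique {γ' : ℕ+ →₀ ℕ} (F' : SetSkyFill γ') (h : F.anchors = F'.anchors) (c : ℕ)
    (i : ℕ+) : maxEntry (F.entry i c) = maxEntry (F'.entry i c) := by
  induction c generalizing i with
  | zero => rw [maxEntry_basement, maxEntry_basement]
  | succ c ih =>
    have h' := F'.greedy c
    have hc' := F'.isColumn c
    simp only [← ih] at h'
    rw [← h] at hc'
    exact congrFun ((F.greedy c).unique h' (F.isColumn c) hc' (F.maxEntry_succ_le c)
      fun i => by rw [ih]; exact F'.maxEntry_succ_le c i) i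

theorem shape_unique {γ' : ℕ+ →₀ ℕ} (F' : SetSkyFill γ') (h : F.anchors = F'.anchors) :
    γ = γ' := by
  ext i
  refine eq_of_forall_le_iff fun c => ?_
  rw [← F.maxEntry_ne_zero_iff, ← F'.maxEntry_ne_zero_iff, F.maxEntry_unique F' h]

theorem eq_of_columns (F' : SetSkyFill γ) (h : F.anchors = F'.anchors) (h' : F.all = F'.all) :
    F = F' := by
  ext i c m
  cases c with
  | zero => rw [F.basement, F'.basement]
  | succ c =>
    rw [mem_entry_iff, mem_entry_iff, h, h']
    simp only [F.maxEntry_unique F' h]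

theorem content_apply (m : ℕ+) : F.content m = {c | m ∈ F.all c}.ncard := by
  have h1 : F.content m = ((γ.support.sigma fun i => Finset.Icc 1 (γ i)).filter
      fun x => m ∈ F.entry x.1 x.2).card := by
    simp only [content, Finsupp.finsetSum_apply, Finsupp.single_apply, Finset.sum_ite_eq',
      Finset.card_filter, Finset.sum_sigma]
  have h2 : {c | m ∈ F.all c} = ↑(((γ.support.sigma fun i => Finset.Icc 1 (γ i)).filter
      fun x => m ∈ F.entry x.1 x.2).image fun x => x.2 - 1) := by
    ext c
    simp only [Set.mem_ofPred_eq, mem_all, Finset.coe_image, Set.mem_image, Finset.coe_filter,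
      Finset.mem_sigma, Finset.mem_Icc, Finsupp.mem_support_iff, Sigma.exists]
    refine exists_congr fun i => ⟨fun h => ?_, ?_⟩
    · have := F.le_of_mem h
      exact ⟨c + 1, ⟨⟨by omega, by omega, this⟩, h⟩, rfl⟩
    · rintro ⟨d, ⟨⟨_, hd, _⟩, h⟩, rfl⟩
      rwa [Nat.sub_add_cancel hd]
  rw [h1, h2, Set.ncard_coe_finset, Finset.card_image_of_injOn]
  rintro ⟨i, c⟩ hi ⟨j, c'⟩ hj h
  simp only [Finset.coe_filter, Finset.mem_sigma, Finset.mem_Icc, Set.mem_ofPred_eq] at hi hj h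
  obtain rfl : c = c' := by omega
  rw [F.row_eq hi.2 hj.2]

end SetSkyFill

/-! ### Construction of a skyline filling from its columns -/

namespace ColumnData

variable {μ : YoungDiagram} (D : ColumnData μ)

theorem exists_greedy : ∃ f : ℕ → ℕ+ → ℕ, (∀ i, f 0 i = i) ∧
    (∀ c, IsColumn (f (c + 1)) (D.anchors c)) ∧ (∀ c i, f (c + 1) i ≤ f c i) ∧
    ∀ c, Greedy (f c) (f (c + 1)) := by
  classical
  have hstep : ∀ c (g : {g : ℕ+ → ℕ // IsColumn g (D.anchors c)}),
      ∃ f : {f : ℕ+ → ℕ // IsColumn f (D.anchors (c + 1))},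
        (∀ i, f.1 i ≤ g.1 i) ∧ Greedy g.1 f.1 := by
    rintro c ⟨g, hg⟩
    obtain ⟨f, hf, hle, hgr⟩ := Greedy.exists (fun t ht => hg.finite ht) (D.anchors (c + 1))
      fun t ht => (D.dominance c t ht).trans (hg.ncard ht).ge
    exact ⟨⟨f, hf⟩, hle, hgr⟩
  choose next hnext hgreedy using hstep
  -- Against the basement the greedy placement puts each `a` into row `a`. This column is given by
  -- hand because the basement has infinitely many entries, outside the scope of `Greedy.exists`.
  let f₁ : ℕ+ → ℕ := fun i => if i ∈ D.anchors 0 then i else 0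
  have hf₁ : IsColumn f₁ (D.anchors 0) := by
    refine ⟨fun i j h h0 => ?_, fun a => ⟨fun ha => ⟨a, if_pos ha⟩, ?_⟩⟩
    · dsimp only [f₁] at h h0
      split_ifs at h h0 with hi hj
      · exact PNat.coe_injective h
      · exact absurd h i.ne_zero
      · exact absurd rfl h0
      · exact absurd rfl h0
    · rintro ⟨i, hi⟩
      dsimp only [f₁] at hi
      split_ifs at hi with h
      · rwa [← PNat.coe_injective hi]
      · exact absurd hi.symm a.ne_zero
  let F : ∀ c, {f : ℕ+ → ℕ // IsColumn f (D.anchors c)} := fun c =>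
    Nat.rec (motive := fun c => {f : ℕ+ → ℕ // IsColumn f (D.anchors c)}) ⟨f₁, hf₁⟩ next c
  refine ⟨fun c => Nat.casesOn c (fun i => i) fun c => (F c).1, fun i => rfl, fun c => (F c).2,
    ?_, ?_⟩
  · rintro (_ | c) i
    · change (if i ∈ D.anchors 0 then (i : ℕ) else 0) ≤ i
      split_ifs <;> simp
    · exact hnext c (F c) i
  · rintro (_ | c)
    · intro i j hij h0 hle
      change (if j ∈ D.anchors 0 then (j : ℕ) else 0) ≤ i at hle
      change (if j ∈ D.anchors 0 then (j : ℕ) else 0) ≠ 0 at h0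
      split_ifs at hle h0
      · exact absurd hij (not_lt.2 (PNat.coe_le_coe _ _ |>.1 hle))
      · exact absurd rfl h0
    · exact hgreedy c (F c)

theorem exists_colLen_eq_zero (μ : YoungDiagram) : ∃ c, μ.colLen c = 0 := by
  refine ⟨μ.rowLen 0, ?_⟩
  by_contra h
  have := YoungDiagram.mem_iff_lt_colLen.2 (Nat.pos_of_ne_zero h)
  exact lt_irrefl _ (YoungDiagram.mem_iff_lt_rowLen.1 this)

theorem exists_shape {f : ℕ → ℕ+ → ℕ} (h0 : ∀ i, f 0 i = i)
    (hcol : ∀ c, IsColumn (f (c + 1)) (D.anchors c)) (hle : ∀ c i, f (c + 1) i ≤ f c i) :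
    ∃ γ : ℕ+ →₀ ℕ, ∀ i c, f c i ≠ 0 ↔ c ≤ γ i := by
  classical
  obtain ⟨N, hN⟩ := exists_colLen_eq_zero μ
  have hzero : ∀ i, ∃ c, f (c + 1) i = 0 := by
    refine fun i => ⟨N, ?_⟩
    by_contra h
    have hA : D.anchors N = ∅ := Finset.card_eq_zero.1 ((D.card N).trans hN)
    have := ((hcol N).mem_iff ⟨f (N + 1) i, by omega⟩).2 ⟨i, rfl⟩
    rw [hA] at this
    exact Finset.notMem_empty _ this
  have hanti : ∀ i, Antitone fun c => f c i := fun i => antitone_nat_of_succ_le fun c => hle c i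
  have key : ∀ i c, f c i ≠ 0 ↔ c ≤ Nat.find (hzero i) := by
    intro i c
    cases c with
    | zero => simp [h0]
    | succ c =>
      rw [Nat.succ_le_iff, Nat.lt_find_iff]
      refine ⟨fun h m hm hm' => ?_, fun h => h c le_rfl⟩
      have : f (c + 1) i ≤ f (m + 1) i := hanti i (by omega)
      omega
  -- A row has positive length only if it meets the first column, which is finite.
  refine ⟨Finsupp.onFinset ((hcol 0).finite one_ne_zero).toFinset
    (fun i => Nat.find (hzero i)) fun i hi => ?_, key⟩
  have := (key i 1).2 (by omega)
  simp only [Set.Finite.mem_toFinset, Set.mem_ofPred_eq, zero_add]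
  omega

/-- The skyline filling with given columns, the anchor entries being placed by `f`. -/
theorem exists_setSkyFill_of_greedy {f : ℕ → ℕ+ → ℕ} (h0 : ∀ i, f 0 i = i)
    (hcol : ∀ c, IsColumn (f (c + 1)) (D.anchors c)) (hle : ∀ c i, f (c + 1) i ≤ f c i)
    (hgr : ∀ c, Greedy (f c) (f (c + 1))) {γ : ℕ+ →₀ ℕ} (hγ : ∀ i c, f c i ≠ 0 ↔ c ≤ γ i) :
    ∃ F : SetSkyFill γ, ∀ c i, maxEntry (F.entry i c) = f c i ∧
      ∀ m, m ∈ F.entry i (c + 1) ↔ m ∈ D.all c ∧ ((m : ℕ) = f (c + 1) i ∨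
        m ∉ D.anchors c ∧ IsLeast {j | f (c + 2) j ≤ m ∧ (m : ℕ) < f (c + 1) j} i) := by
  classical
  obtain ⟨entry, hzero, hmem⟩ : ∃ entry : ℕ+ → ℕ → Finset ℕ+, (∀ i, entry i 0 = {i}) ∧
      ∀ i c m, m ∈ entry i (c + 1) ↔ m ∈ D.all c ∧ ((m : ℕ) = f (c + 1) i ∨
        m ∉ D.anchors c ∧ IsLeast {j | f (c + 2) j ≤ m ∧ (m : ℕ) < f (c + 1) j} i) :=
    ⟨fun i c => Nat.casesOn c {i} fun c =>
      (D.all c).filter fun m => (m : ℕ) = f (c + 1) i ∨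
        m ∉ D.anchors c ∧ IsLeast {j | f (c + 2) j ≤ m ∧ (m : ℕ) < f (c + 1) j} i,
      fun i => rfl, fun i c m => Finset.mem_filter⟩
  have hmax : ∀ c i, maxEntry (entry i c) = f c i := by
    intro c i
    cases c with
    | zero => rw [hzero, h0, maxEntry, Finset.sup_singleton]
    | succ c =>
      apply le_antisymm
      · refine Finset.sup_le fun m hm => ?_
        rcases ((hmem i c m).1 hm).2 with h | h
        · exact h.le
        · exact h.2.1.2.le
      · rcases Nat.eq_zero_or_pos (f (c + 1) i) with h | h
        · rw [h]
          exact Nat.zero_le _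
        · exact le_maxEntry (a := ⟨f (c + 1) i, h⟩) ((hmem _ _ _).2
            ⟨D.subset c (((hcol c).mem_iff _).2 ⟨i, rfl⟩), Or.inl rfl⟩)
  have hne : ∀ i c, (entry i c).Nonempty ↔ c ≤ γ i := fun i c => by
    rw [← maxEntry_ne_zero, hmax, hγ]
  have hanchor : ∀ i c, c ≤ γ i → (anchor (entry i c) : ℕ) = f c i := fun i c h => by
    rw [← maxEntry_eq_anchor ((hne i c).2 h), hmax]
  have hanc : ∀ i c (m : ℕ+), (m : ℕ) = f (c + 1) i → m ∈ D.anchors c := fun i c m h =>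
    ((hcol c).mem_iff m).2 ⟨i, h.symm⟩
  exact ⟨{
     entry := entry
     nonempty_iff := hne
     basement := hzero
     column_disjoint := by
      intro i j c hij
      rw [Finset.disjoint_left]
      intro m hi hj
      apply hij
      cases c with
      | zero =>
        rw [hzero, Finset.mem_singleton] at hi hj
        rw [← hi, ← hj]
      | succ c =>
        rcases ((hmem _ _ _).1 hi).2 with h1 | h1 <;> rcases ((hmem _ _ _).1 hj).2 with h2 | h2
        · exact (hcol c).inj i j (h1.symm.trans h2) (by have := m.pos; omega)
        · exact absurd (hanc _ _ _ h1) h2.1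
        · exact absurd (hanc _ _ _ h2) h1.1
        · exact h1.2.unique h2.2
     row_weak := by
      intro i c a ha b hb
      have h1 := le_maxEntry hb
      rw [hmax] at h1
      rw [← PNat.coe_le_coe]
      cases c with
      | zero =>
        rw [hzero, Finset.mem_singleton] at ha
        have := hle 0 i
        rw [h0] at this
        rw [ha]
        exact h1.trans this
      | succ c =>
        rcases ((hmem _ _ _).1 ha).2 with h2 | h2
        · rw [h2]
          exact h1.trans (hle _ i)
        · exact h1.trans h2.2.1.1
     triple_A := by
      intro i j k hij hγ' hk
      simp only [IsInversionTriple, ← PNat.coe_lt_coe, ← PNat.coe_le_coe]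
      rw [hanchor _ _ (by omega), hanchor _ _ (by omega), hanchor _ _ (by omega)]
      -- If the entry of row `j` is at most its neighbour `(i, k)`, greediness makes it smaller than
      -- `(i, k + 1)`; otherwise the first form of an inversion triple holds.
      have h1 := hgr k i j hij ((hγ _ _).2 hk)
      have h2 := hle k i
      omega
     triple_B := by
      intro i j k hij hγ' hk
      simp only [IsInversionTriple, ← PNat.coe_lt_coe, ← PNat.coe_le_coe]
      rw [hanchor _ _ (by omega), hanchor _ _ (by omega), hanchor _ _ (by omega)]
      exact Or.inr ⟨hle k j, Greedy.lt_of_shorter hγ hle hgr hij hγ' hk⟩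
     free_highest := by
      rintro i c e he hea i' hi' hc ⟨h1, h2⟩
      have hci := (hne i c).1 ⟨e, he⟩
      cases c with
      | zero =>
        rw [hzero, Finset.mem_singleton] at he
        apply hea
        rw [← PNat.coe_inj, hanchor _ _ hci, h0, he]
      | succ c =>
        rcases ((hmem _ _ _).1 he).2 with h | h
        · apply hea
          rw [← PNat.coe_inj, hanchor _ _ hci, h]
        · refine (mem_lowerBounds.1 h.2.2 i' ⟨?_, ?_⟩).not_gt hi'
          · rw [← hmax]
            exact Finset.sup_le fun b hb => h2 b hb
          · rwa [← PNat.coe_lt_coe, hanchor _ _ hc] at h1 },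
   fun c i => ⟨hmax c i, hmem i c⟩⟩

theorem exists_setSkyFill : ∃ (γ : ℕ+ →₀ ℕ) (F : SetSkyFill γ),
    F.anchors = D.anchors ∧ F.all = D.all := by
  obtain ⟨f, h0, hcol, hle, hgr⟩ := D.exists_greedy
  obtain ⟨γ, hγ⟩ := D.exists_shape h0 hcol hle
  obtain ⟨F, hF⟩ := D.exists_setSkyFill_of_greedy h0 hcol hle hgr hγ
  refine ⟨γ, F, ?_, ?_⟩
  · ext c a
    rw [(F.isColumn c).mem_iff, (hcol c).mem_iff]
    simp only [(hF (c + 1) _).1]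
  · ext c m
    rw [F.mem_all]
    simp only [(hF c _).2]
    refine ⟨fun ⟨_, h⟩ => h.1, fun hm => ?_⟩
    by_cases ha : m ∈ D.anchors c
    · obtain ⟨i, hi⟩ := ((hcol c).mem_iff m).1 ha
      exact ⟨i, hm, Or.inl hi.symm⟩
    -- The strict inequality of counts supplies a row that accepts the free entry, and well-ordering
    -- supplies the highest such row.
    · obtain ⟨i, hi, hmin⟩ := WellFounded.has_min (wellFounded_lt (α := ℕ+)) _
        (((hcol c).countGE_lt_iff (hcol (c + 1)) (hle (c + 1)) m).1 (D.free c m hm ha))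
      exact ⟨i, hm, Or.inr ⟨ha, hi, fun j hj => not_lt.1 (hmin j hj)⟩⟩

end ColumnData

/-! ### Column lengths and parts of the shape -/

theorem lt_countP_iff_of_sortedGE (w : List ℕ) (hw : w.Pairwise (· ≥ ·)) (i c : ℕ) :
    i < w.countP (c < ·) ↔ ∃ h : i < w.length, c < w[i] := by
  induction w generalizing i with
  | nil => simp
  | cons a w ih =>
    rw [List.pairwise_cons] at hw
    by_cases hc : c < a
    · rw [List.countP_cons_of_pos (by simpa using hc)]
      cases i with
      | zero => simpa using hc
      | succ i => simpa using ih hw.2 i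
    · have h0 : (a :: w).countP (c < ·) = 0 := by
        rw [List.countP_eq_zero]
        intro b hb
        rcases List.mem_cons.1 hb with rfl | hb
        · simpa using hc
        · have := hw.1 b hb
          simp only [decide_eq_true_eq]
          omega
      rw [h0]
      refine iff_of_false (Nat.not_lt_zero _) ?_
      rintro ⟨h, hlt⟩
      have hmem : (a :: w)[i] ∈ a :: w := List.getElem_mem h
      rcases List.mem_cons.1 hmem with he | hmem
      · omega
      · have := hw.1 _ hmem
        omega

theorem colLen_partitionDiagram {n : ℕ} (lam : n.Partition) (c : ℕ) :
    (partitionDiagram lam).colLen c = lam.parts.countP (c < ·) := by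
  have h : lam.parts.countP (c < ·) = (lam.parts.sort (· ≥ ·)).countP (c < ·) := by
    conv_lhs => rw [← Multiset.sort_eq lam.parts (· ≥ ·)]
    rw [Multiset.coe_countP]
  rw [h]
  refine eq_of_forall_lt_iff fun i => ?_
  rw [lt_countP_iff_of_sortedGE _ (Multiset.pairwise_sort _ _), ← YoungDiagram.mem_iff_lt_colLen,
    partitionDiagram, YoungDiagram.mem_ofRowLens]

/-- The multiplicity of `c + 1` is the difference of the counts at `c` and `c + 1`; positivity
disposes of the value `0`, which these counts do not see. -/
theorem Multiset.eq_of_countP_lt {s t : Multiset ℕ} (hs : ∀ a ∈ s, 0 < a) (ht : ∀ a ∈ t, 0 < a)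
    (h : ∀ c, s.countP (c < ·) = t.countP (c < ·)) : s = t := by
  have key : ∀ (s : Multiset ℕ) c, s.countP (c < ·) = s.countP (c + 1 < ·) + s.count (c + 1) := by
    intro s c
    induction s using Multiset.induction_on with
    | empty => simp
    | cons a s ih =>
      rw [Multiset.countP_cons, Multiset.countP_cons, Multiset.count_cons, ih]
      split_ifs <;> omega
  ext a
  cases a with
  | zero =>
    rw [Multiset.count_eq_zero_of_notMem fun h => lt_irrefl _ (hs 0 h),
      Multiset.count_eq_zero_of_notMem fun h => lt_irrefl _ (ht 0 h)]
  | succ c =>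
    have h1 := key s c
    have h2 := key t c
    rw [h, h] at h1
    omega

theorem coe_positivePart (γ : ℕ+ →₀ ℕ) :
    (positivePart γ : Multiset ℕ) = γ.support.val.map γ := by
  rw [positivePart, ← Multiset.map_coe, Finset.sort_eq]

theorem countP_positivePart (γ : ℕ+ →₀ ℕ) (c : ℕ) :
    (positivePart γ : Multiset ℕ).countP (c < ·) = (γ.support.filter fun i => c < γ i).card := by
  rw [coe_positivePart, Multiset.countP_map]
  rfl

theorem sum_positivePart (γ : ℕ+ →₀ ℕ) : (positivePart γ).sum = γ.degree := by
  rw [← Multiset.sum_coe, coe_positivePart]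
  rfl

theorem pos_of_mem_positivePart (γ : ℕ+ →₀ ℕ) : ∀ a ∈ positivePart γ, 0 < a := by
  intro a ha
  obtain ⟨i, hi, rfl⟩ := List.mem_map.1 ha
  exact Nat.pos_of_ne_zero (Finsupp.mem_support_iff.1 ((Finset.mem_sort _).1 hi))

/-! ### The bijection and the comparison of coefficients -/

/-- Finite support matters: without it the left side has the default value `0`, while the iterated
sum may not vanish. -/
theorem finsum_sigma {ι M : Type*} {κ : ι → Type*} [AddCommMonoid M] (f : (Σ i, κ i) → M)
    (hf : (Function.support f).Finite) : ∑ᶠ x, f x = ∑ᶠ i, ∑ᶠ k, f ⟨i, k⟩ := by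
  classical
  let s := hf.toFinset
  have hs : ∀ x, f x ≠ 0 → x ∈ s := fun x hx => hf.mem_toFinset.2 hx
  let t : ∀ i, Finset (κ i) := fun i => s.preimage (Sigma.mk i) sigma_mk_injective.injOn
  have h1 : ∀ i, ∑ᶠ k, f ⟨i, k⟩ = ∑ k ∈ t i, f ⟨i, k⟩ := fun i =>
    finsum_eq_sum_of_support_subset _ fun k hk => by
      simpa [t] using hs ⟨i, k⟩ hk
  have h2 : ∑ᶠ i, ∑ᶠ k, f ⟨i, k⟩ = ∑ i ∈ s.image Sigma.fst, ∑ᶠ k, f ⟨i, k⟩ := by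
    refine finsum_eq_sum_of_support_subset _ fun i hi => ?_
    obtain ⟨k, hk⟩ : ∃ k, f ⟨i, k⟩ ≠ 0 := by
      by_contra! h
      exact hi (finsum_eq_zero_of_forall_eq_zero h)
    exact Finset.mem_coe.2 (Finset.mem_image.2 ⟨⟨i, k⟩, hs _ hk, rfl⟩)
  rw [h2, Finset.sum_congr rfl fun i _ => h1 i, Finset.sum_sigma',
    finsum_eq_sum_of_support_subset _ fun x hx => ?_]
  have hx' := hs x hx
  rw [Finset.mem_coe, Finset.mem_sigma]
  exact ⟨Finset.mem_image_of_mem _ hx', by simpa [t] using hx'⟩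

/-- The skyline fillings whose shape has the parts of `lam` as its nonzero parts. -/
abbrev SkyFillOf {n : ℕ} (lam : n.Partition) : Type :=
  Σ α : {α : Composition n // Nat.Partition.ofComposition n α = lam},
    Σ γ : {γ : ℕ+ →₀ ℕ // positivePart γ = α.1.blocks}, SetSkyFill γ.1

namespace SkyFillOf

variable {n : ℕ} {lam : n.Partition}

theorem card_column (x : SkyFillOf lam) (c : ℕ) :
    (x.2.1.1.support.filter fun i => c < x.2.1.1 i).card = (partitionDiagram lam).colLen c := by
  rw [colLen_partitionDiagram, ← countP_positivePart, x.2.1.2]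
  exact congrArg (fun p : n.Partition => p.parts.countP (c < ·)) x.1.2

/-- The columns of a skyline filling of one of the shapes belonging to `lam`. -/
def columnData (x : SkyFillOf lam) : ColumnData (partitionDiagram lam) :=
  x.2.2.columnData x.card_column

theorem columnData_injective : Function.Injective (columnData (lam := lam)) := by
  rintro ⟨⟨α, hα⟩, ⟨γ, hγ⟩, F⟩ ⟨⟨α', hα'⟩, ⟨γ', hγ'⟩, F'⟩ h
  have h1 : F.anchors = F'.anchors := congrArg ColumnData.anchors h
  have h2 : F.all = F'.all := congrArg ColumnData.all h
  obtain rfl := F.shape_unique F' h1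
  obtain rfl : α = α' := Composition.ext (hγ.symm.trans hγ')
  obtain rfl := F.eq_of_columns F' h1 h2
  rfl

theorem columnData_surjective : Function.Surjective (columnData (lam := lam)) := by
  intro D
  obtain ⟨γ, F, h1, h2⟩ := D.exists_setSkyFill
  have hparts : (positivePart γ : Multiset ℕ) = lam.parts := by
    refine Multiset.eq_of_countP_lt (pos_of_mem_positivePart γ) (fun _ => lam.parts_pos) fun c => ?_
    rw [countP_positivePart, ← F.card_anchors, h1, D.card, colLen_partitionDiagram]
  let α : Composition n :=
    { blocks := positivePart γ
      blocks_pos := fun {a} h => pos_of_mem_positivePart γ a h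
      blocks_sum := by rw [← Multiset.sum_coe, hparts, lam.parts_sum] }
  refine ⟨⟨⟨α, Nat.Partition.ext hparts⟩, ⟨γ, rfl⟩, F⟩, ?_⟩
  exact ColumnData.ext h1 h2

theorem degree_shape (x : SkyFillOf lam) : x.2.1.1.degree = n := by
  rw [← sum_positivePart, x.2.1.2, x.1.1.blocks_sum]

/-- The bijection between set-valued reverse tableaux and skyline fillings that preserves the
columns. -/
noncomputable def equivSetRT (lam : n.Partition) : SetRT (partitionDiagram lam) ≃ SkyFillOf lam :=
  (Equiv.ofBijective _ (SetRT.columnData_bijective _)).trans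
    (Equiv.ofBijective _ ⟨columnData_injective, columnData_surjective⟩).symm

theorem content_equivSetRT (T : SetRT (partitionDiagram lam)) :
    (equivSetRT lam T).2.2.content = T.content := by
  have h : (equivSetRT lam T).columnData = T.columnData :=
    (Equiv.ofBijective _ ⟨columnData_injective, columnData_surjective⟩).apply_symm_apply _
  have h' : (equivSetRT lam T).2.2.all = T.all := congrArg ColumnData.all h
  ext m
  rw [SetSkyFill.content_apply, SetRT.content_apply, h']

end SkyFillOf

theorem coeff_formalSum {ι σ R : Type*} [CommSemiring R] (f : ι → MvPowerSeries σ R)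
    (d : σ →₀ ℕ) :
    MvPowerSeries.coeff d (formalSum f) = ∑ᶠ i, MvPowerSeries.coeff d (f i) := rfl

theorem corollary1p3 (n : ℕ) (lam : n.Partition) :
    grothendieck lam =
      ∑ α : Composition n with Nat.Partition.ofComposition n α = lam, quasiGrothendieck α := by
  classical
  ext1 d
  let f : SkyFillOf lam → Polynomial ℤ := fun x => MvPowerSeries.coeff d
    (MvPowerSeries.monomial x.2.2.content
      (Polynomial.X ^ (x.2.2.content.degree - x.2.1.1.degree)) : GrothSeries)
  have hf : ∀ T, f (SkyFillOf.equivSetRT lam T) = MvPowerSeries.coeff d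
      (MvPowerSeries.monomial T.content (Polynomial.X ^ (T.content.degree - n)) :
        GrothSeries) := fun T => by
    simp only [f, SkyFillOf.content_equivSetRT, SkyFillOf.degree_shape]
  -- Finiteness is known for tableaux with a given content and is carried over by the bijection.
  have hfin : (Function.support f).Finite := by
    refine ((locallyFinite_grothendieck lam d).image (SkyFillOf.equivSetRT lam)).subset ?_
    intro x hx
    refine ⟨(SkyFillOf.equivSetRT lam).symm x, ?_, Equiv.apply_symm_apply _ _⟩
    rw [Set.mem_ofPred_eq, ← hf, Equiv.apply_symm_apply]
    exact hx
  have hfin' : ∀ α, (Function.support fun y => f ⟨α, y⟩).Finite := fun α =>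
    hfin.preimage sigma_mk_injective.injOn
  calc MvPowerSeries.coeff d (grothendieck lam)
      = ∑ᶠ T, f (SkyFillOf.equivSetRT lam T) := by
        rw [grothendieck, coeff_formalSum]
        exact finsum_congr fun T => (hf T).symm
    _ = ∑ᶠ x, f x := finsum_comp_equiv _
    _ = ∑ᶠ α, ∑ᶠ y, f ⟨α, y⟩ := finsum_sigma f hfin
    _ = ∑ᶠ α : {α : Composition n // Nat.Partition.ofComposition n α = lam},
          MvPowerSeries.coeff d (quasiGrothendieck α.1) := by
        refine finsum_congr fun α => ?_
        rw [finsum_sigma _ (hfin' α), quasiGrothendieck, coeff_formalSum]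
        refine finsum_congr fun γ => ?_
        rw [lascouxAtom, coeff_formalSum]
    _ = _ := by
        rw [finsum_eq_sum_of_fintype, map_sum]
        refine (Finset.sum_subtype _ (fun α => ?_)
          fun α => MvPowerSeries.coeff d (quasiGrothendieck α)).symm
        exact Finset.mem_filter_univ α
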